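/- Let $n,k\ge 0$ and let $\mathcal A=(\mathcal A_0,\dots,\mathcal A_k)$ be a point configuration in $\mathbb Z^n$, i.e. a tuple of finite subsets $\mathcal A_i\subset\mathbb Z^n$. The dimension of a set is the dimension of its affine span (with $\dim\emptyset=-1$), and $\dim(\mathcal A):=\dim(\mathcal A_0+\dots+\mathcal A_k)$. A *cell* of $\mathcal A$ is a tuple $C=(C_0,\dots,C_k)$ with $C_i\subseteq\mathcal A_i$, and $\operatorname{conv}(C):=\operatorname{conv}(C_0+\dots+C_k)$. For a tuple $P=(P_0,\dots,P_k)$ of finite sets in a real vector space and a covector $\gamma$, the *face* of $P$ cut out by $\gamma$ is $P^\gamma=(P_0^\gamma,\dots,P_k^\gamma)$, where $P_i^\gamma$ is the set of points of $P_i$ at which $\gamma$ is minimal on $P_i$. A *subdivision* of $\mathcal A$ is a finite collection $S$ of cells of $\mathcal A$ such that $\dim(\operatorname{conv}(C))=\dim(\mathcal A)$ for all $C\in S$; for all $C,C'\in S$ the set $\operatorname{conv}(C)\cap\operatorname{conv}(C')$ is empty or is both of the form $\operatorname{conv}(C^{\gamma})$ and of the form $\operatorname{conv}(C'^{\gamma'})$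 for some covectors $\gamma,\gamma'$; and $\bigcup_{C\in S}\operatorname{conv}(C)=\operatorname{conv}(\mathcal A)$. It is *fine mixed* if every $C\in S$ satisfies $$\sum_j\dim(\operatorname{conv}(C_j))=\dim(\mathcal A)\quad\text{and}\quad\sum_j(|C_j|-1)=\dim(\mathcal A).$$ A collection $S_1$ of cells *refines* $S_2$ if for each $C\in S_1$ there is $D\in S_2$ with $C_i\subseteq D_i$ for all $i$. A *weight vector* is $w\in\mathbb R^{|\mathcal A_0|}\times\dots\times\mathbb R^{|\mathcal A_k|}$, with entries $w_{i,a}$ for $a\in\mathcal A_i$; $\|\cdot\|$ is the Euclidean norm. The lifted configuration $\mathcal A_w$ in $\mathbb R^{n}\times\mathbb R$ consists of the sets $\{(a,w_{i,a}) : a\in\mathcal A_i\}$. A *lower facet* of $\mathcal A_w$ is a face $\Phi$ of $\mathcal A_w$ with $\dim(\operatorname{conv}(\Phi_0+\dots+\Phi_k))=\dim(\mathcal A)$ that is cut out by some covector with positive last coordinate. The *coherent subdivision* $S_w$ consists of the images of all lower facets of $\mathcal A_w$ under the projection forgetting the last coordinate. **Lemma.** Suppose $\dim(\mathcal A)=n$.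 Then there are finitely many proper linear subspaces of the space of weight vectors such that for every weight vector $w$ there is $\varepsilon_0>0$ with the following property: for every $0<\varepsilon\le\varepsilon_0$ and every weight vector $w'$ that lies outside the union of these subspaces and satisfies $\|w-w'\|<\varepsilon$, the collection $S_{w'}$ is a fine mixed subdivision of $\mathcal A$ and refines $S_w$. -/

import Mathlib

open scoped Pointwise

noncomputable section

/-- Tuples `(A_0, …, A_k)` of finite subsets of `ℤⁿ`: the point configurations in `ℤⁿ`. A cell of a
configuration is a tuple of the same kind, contained in it entry by entry. -/
abbrev PointConfig (n k : ℕ) : Type := Fin (k + 1) → Finset (Fin n → ℤ)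

namespace PointConfig

section RealTuples

variable {E : Type*} [AddCommGroup E] [Module ℝ E] {k : ℕ}

/-- The dimension of a subset of a real vector space: the dimension of its affine span, with
`dim ∅ = -1`. -/
def dimSet (s : Set E) : ℤ :=
  open scoped Classical in
  if s.Nonempty then (Module.finrank ℝ (affineSpan ℝ s).direction : ℤ) else -1

/-- The convex hull `conv (P_0 + ⋯ + P_k)` of the Minkowski sum of a tuple of sets. -/
def convTuple (P : Fin (k + 1) → Set E) : Set E := convexHull ℝ (∑ i, P i)

/-- The face `P^γ = (P_0^γ, …, P_k^γ)` of a tuple of sets: `P_i^γ` consists of the points of `P_i`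
at which the covector `γ` is minimal on `P_i`. -/
def faceTuple (P : Fin (k + 1) → Set E) (γ : Module.Dual ℝ E) : Fin (k + 1) → Set E :=
  fun i => {x | x ∈ P i ∧ ∀ y ∈ P i, γ x ≤ γ y}

end RealTuples

variable {n k : ℕ}

/-- The inclusion `ℤⁿ ⊂ ℝⁿ`. -/
def toReal (a : Fin n → ℤ) : Fin n → ℝ := fun j => (a j : ℝ)

/-- A configuration (or cell) seen as a tuple of subsets of `ℝⁿ`. -/
def realPts (A : PointConfig n k) : Fin (k + 1) → Set (Fin n → ℝ) :=
  fun i => toReal '' (A i : Set (Fin n → ℤ))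

/-- `conv A = conv (A_0 + ⋯ + A_k)`. -/
def conv (A : PointConfig n k) : Set (Fin n → ℝ) := convTuple A.realPts

/-- `dim A`, the dimension of the affine span of `A_0 + ⋯ + A_k`. -/
def dim (A : PointConfig n k) : ℤ := dimSet (∑ i, A.realPts i)

/-- `C` is a cell of `A`. -/
def IsCell (A C : PointConfig n k) : Prop := ∀ i, C i ⊆ A i

/-- The set `F` is a face of the cell `C`: it is empty, or it is the convex hull of the face `C^γ`
for some covector `γ`. -/
def IsFace (F : Set (Fin n → ℝ)) (C : PointConfig n k) : Prop :=
  F = ∅ ∨ ∃ γ : Module.Dual ℝ (Fin n → ℝ), F = convTuple (faceTuple C.realPts γ)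

/-- `S` is a subdivision of `A`. -/
structure IsSubdivision (A : PointConfig n k) (S : Set (PointConfig n k)) : Prop where
  finite : S.Finite
  isCell : ∀ C ∈ S, A.IsCell C
  dim_eq : ∀ C ∈ S, dimSet C.conv = A.dim
  inter : ∀ C₁ ∈ S, ∀ C₂ ∈ S, IsFace (C₁.conv ∩ C₂.conv) C₁ ∧ IsFace (C₁.conv ∩ C₂.conv) C₂
  cover : ⋃ C ∈ S, C.conv = A.conv

/-- `S` is a mixed subdivision of `A`. -/
def IsMixed (A : PointConfig n k) (S : Set (PointConfig n k)) : Prop :=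
  A.IsSubdivision S ∧ ∀ C ∈ S, ∑ j, dimSet (convexHull ℝ (C.realPts j)) = A.dim

/-- `S` is a fine mixed subdivision of `A`. -/
def IsFineMixed (A : PointConfig n k) (S : Set (PointConfig n k)) : Prop :=
  A.IsMixed S ∧ ∀ C ∈ S, ∑ j, (((C j).card : ℤ) - 1) = A.dim

/-- `S₁` refines `S₂`: each cell of `S₁` is contained, entry by entry, in a cell of `S₂`. -/
def Refines (S₁ S₂ : Set (PointConfig n k)) : Prop :=
  ∀ C ∈ S₁, ∃ D ∈ S₂, ∀ i, C i ⊆ D i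

/-- Weight vectors `w ∈ ℝ^|A_0| × ⋯ × ℝ^|A_k|`, with one entry for each index `i` and each point
of `A_i`, and with the Euclidean norm. -/
abbrev WeightVector (A : PointConfig n k) : Type :=
  EuclideanSpace ℝ (Σ i : Fin (k + 1), {a : Fin n → ℤ // a ∈ A i})

/-- The lifted configuration `A_w` in `ℝⁿ × ℝ`, with `A_{i,w} = {(a, w_a) | a ∈ A_i}`. -/
def lifted (A : PointConfig n k) (w : A.WeightVector) : Fin (k + 1) → Set ((Fin n → ℝ) × ℝ) :=
  fun i => Set.range fun a : {a : Fin n → ℤ // a ∈ A i} => (toReal a.1, w ⟨i, a⟩)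

/-- `Φ` is a lower facet of `A_w`: a face of `A_w` of dimension `dim A` which is cut out by a
covector with positive last coordinate. If `dim A_w = dim A + 1`, then every covector that cuts out
such a face has positive last coordinate; if `dim A_w = dim A`, then the only lower facet is `A_w`
itself. -/
def IsLowerFacet (A : PointConfig n k) (w : A.WeightVector)
    (Φ : Fin (k + 1) → Set ((Fin n → ℝ) × ℝ)) : Prop :=
  dimSet (convTuple Φ) = A.dim ∧
    ∃ γ : Module.Dual ℝ ((Fin n → ℝ) × ℝ), 0 < γ (0, 1) ∧ Φ = faceTuple (A.lifted w) γ

/-- The coherent subdivision `S_w`: the cells that are the images of the lower facets of `A_w`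
under the projection `ℝⁿ × ℝ → ℝⁿ`. -/
def coherentSubdivision (A : PointConfig n k) (w : A.WeightVector) : Set (PointConfig n k) :=
  {C | ∃ Φ, A.IsLowerFacet w Φ ∧ ∀ i, C.realPts i = Prod.fst '' Φ i}

end PointConfig

end

/-!
The cells of a coherent subdivision are described by linear algebra. A pair `q = (v, c)` of a
covector and constants `c_0, …, c_k` gives the affine functions `c_i - v` on the summands
(`AffTuple`, `height`). A lower facet of the lifted configuration is given by a `q` whose heights
are at most the weights, and its cell consists of the points where equality holds (`tight`);
full-dimensionality means that `q` is determined by its heights on the cell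
(`mem_coherentSubdivision_iff`, `fullDim_iff`).

For any weights this gives a subdivision. Two cells that meet do so along the face cut out by the
difference of their covectors, since on the hull of one cell its own total height `∑ i, c_i - v x`
is the larger of the two (`isFace_tight_inter`). That the cells cover `conv A` is linear
programming: for a fixed point `x`, every `q` below the weights can be moved to one with a
full-dimensional tight cell without decreasing the total height at `x` (`exists_tight_lt`); these
are finite in number, and the best one has `x` in the hull of its cell, since otherwise a separating
hyperplane would allow an improvement (`mem_conv_tight_of_max`).

The subspaces to be avoided are, for each cell `C`, the weights whose restriction to `C` consists of
heights (`liftSubmodule`), whenever this is a proper subspace. For a cell `C` of the subdivision of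
other weights, all functions on `C` are heights. As `q` is determined by its heights on `C`, the
number of points of `C` is `n + k + 1` (`sum_card_sub_one`), and each `C_j` is affinely independent
(`dimSet_convexHull_realPts`), so the subdivision is fine mixed.

Refinement needs no genericity. The weights for which a full-dimensional `C` lies in a tight cell
form a closed set, because `q` depends linearly on the weights on `C` (`isClosed_setOf_le_tight`).
There are finitely many `C`, so the cells occurring for weights close to `w` all lie in cells of
`S_w` (`eventually_refines`).
-/

open scoped Pointwise

noncomputable section

namespace PointConfig

/-! ### Dimensions and faces of Minkowski sums -/

section RealTuples

variable {E : Type*} [AddCommGroup E] [Module ℝ E] {k : ℕ}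

lemma dimSet_convexHull (s : Set E) : dimSet (convexHull ℝ s) = dimSet s := by
  unfold dimSet
  rw [affineSpan_convexHull, convexHull_nonempty_iff]

/-- A set has full dimension when no nonzero covector is constant on it. -/
lemma dimSet_eq_finrank_iff [FiniteDimensional ℝ E] (s : Set E) :
    dimSet s = Module.finrank ℝ E ↔
      s.Nonempty ∧ ∀ (v : Module.Dual ℝ E) (c : ℝ), (∀ x ∈ s, v x = c) → v = 0 := by
  unfold dimSet
  split_ifs with hs
  · rw [direction_affineSpan, Nat.cast_inj]
    simp only [hs, true_and]
    constructor
    · intro h v c hv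
      have htop : vectorSpan ℝ s = ⊤ := Submodule.eq_top_of_finrank_eq h
      have hle : vectorSpan ℝ s ≤ LinearMap.ker v := by
        rw [vectorSpan, Submodule.span_le]
        rintro _ ⟨x, hx, y, hy, rfl⟩
        simp [hv x hx, hv y hy]
      rw [htop, top_le_iff] at hle
      exact LinearMap.ker_eq_top.1 hle
    · intro h
      by_contra hne
      have hlt : vectorSpan ℝ s < ⊤ := by
        rw [lt_top_iff_ne_top]
        intro ht
        rw [ht, finrank_top] at hne
        exact hne rfl
      obtain ⟨f, hf0, hf⟩ := Submodule.exists_le_ker_of_lt_top _ hlt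
      obtain ⟨x₀, hx₀⟩ := hs
      refine hf0 (h f (f x₀) fun x hx => ?_)
      have := hf (vsub_mem_vectorSpan ℝ hx hx₀)
      simpa [sub_eq_zero] using this
  · simp only [hs, false_and]

lemma dimSet_image_of_disjoint_ker {F : Type*} [AddCommGroup F] [Module ℝ F] (f : E →ₗ[ℝ] F)
    (s : Set E) (h : Disjoint (vectorSpan ℝ s) (LinearMap.ker f)) :
    dimSet (f '' s) = dimSet s := by
  have himg : vectorSpan ℝ (f '' s) = (vectorSpan ℝ s).map f := by
    simpa using (AffineMap.map_vectorSpan f.toAffineMap (s := s)).symm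
  have hrank : Module.finrank ℝ ((vectorSpan ℝ s).map f) = Module.finrank ℝ (vectorSpan ℝ s) := by
    rw [← LinearMap.range_domRestrict]
    refine LinearMap.finrank_range_of_inj (LinearMap.ker_eq_bot.1 ?_)
    rw [LinearMap.ker_domRestrict, ← Submodule.disjoint_iff_comap_eq_bot]
    exact h
  unfold dimSet
  rw [direction_affineSpan, direction_affineSpan, himg, hrank, Set.image_nonempty]

lemma convTuple_mono {P Q : Fin (k + 1) → Set E} (h : ∀ i, P i ⊆ Q i) :
    convTuple P ⊆ convTuple Q := by
  refine convexHull_mono ?_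
  exact Set.finsetSum_subset_finsetSum _ _ _ fun i _ => h i

lemma mem_convTuple_iff {P : Fin (k + 1) → Set E} {x : E} :
    x ∈ convTuple P ↔ ∃ y : Fin (k + 1) → E, (∀ i, y i ∈ convexHull ℝ (P i)) ∧ ∑ i, y i = x := by
  rw [convTuple, convexHull_sum, Set.mem_fintype_sum]
  simp

/-- If a covector is bounded below by `c` on a set, the points of the convex hull at which the bound
is attained are convex combinations of points of the set at which it is attained. -/
lemma mem_convexHull_inter_of_eq {s : Set E} {v : Module.Dual ℝ E} {c : ℝ}
    (hs : ∀ x ∈ s, c ≤ v x) {x : E} (hx : x ∈ convexHull ℝ s) (hxc : v x = c) :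
    x ∈ convexHull ℝ {y | y ∈ s ∧ v y = c} := by
  set H := convexHull ℝ {y | y ∈ s ∧ v y = c} with hH
  have hHc : Convex ℝ H := convex_convexHull _ _
  have hK : Convex ℝ {x | c ≤ v x ∧ (v x = c → x ∈ H)} := by
    rintro x ⟨hx, hx'⟩ y ⟨hy, hy'⟩ a b ha hb hab
    have hval : v (a • x + b • y) = a * v x + b * v y := by simp
    refine ⟨convex_halfSpace_ge v.isLinear c hx hy ha hb hab, fun h => ?_⟩
    rw [hval] at h
    have h0 : a * (v x - c) + b * (v y - c) = 0 := by linear_combination h - c * hab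
    have h1 := mul_nonneg ha (sub_nonneg.2 hx)
    have h2 := mul_nonneg hb (sub_nonneg.2 hy)
    rcases ha.eq_or_lt with rfl | ha
    · have : b = 1 := by linarith
      subst this
      simpa using hy' (by linarith)
    rcases hb.eq_or_lt with rfl | hb
    · have : a = 1 := by linarith
      subst this
      simpa using hx' (by linarith)
    have h3 : a * (v x - c) = 0 := by linarith
    have h4 : b * (v y - c) = 0 := by linarith
    refine hHc (hx' ?_) (hy' ?_) ha.le hb.le hab
    · rcases mul_eq_zero.1 h3 with h | h <;> linarith
    · rcases mul_eq_zero.1 h4 with h | h <;> linarith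
  exact (convexHull_min (t := {x | c ≤ v x ∧ (v x = c → x ∈ H)})
    (fun y hy => ⟨hs y hy, fun h => subset_convexHull ℝ _ ⟨hy, h⟩⟩) hK hx).2 hxc

/-- If `v` is at least `c i` on `P i` for all `i`, then `v` is at least `∑ i, c i` on
`conv (P_0 + ⋯ + P_k)`. -/
lemma sum_le_of_mem_convTuple {P : Fin (k + 1) → Set E} {v : Module.Dual ℝ E}
    {c : Fin (k + 1) → ℝ} (hP : ∀ i, ∀ x ∈ P i, c i ≤ v x) {x : E} (hx : x ∈ convTuple P) :
    ∑ i, c i ≤ v x := by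
  obtain ⟨y, hy, rfl⟩ := mem_convTuple_iff.1 hx
  rw [map_sum]
  exact Finset.sum_le_sum fun i _ =>
    convexHull_min (hP i) (convex_halfSpace_ge v.isLinear (c i)) (hy i)

/-- If `v ≥ c i` on `P i`, and the resulting bound `∑ i, c i` on `conv (P_0 + ⋯ + P_k)` is attained
at `x`, then `x` lies in the convex hull of the face cut out by `v`, and `v = c i` on its `i`-th
part. -/
lemma mem_convTuple_faceTuple {P : Fin (k + 1) → Set E} {v : Module.Dual ℝ E}
    {c : Fin (k + 1) → ℝ} (hP : ∀ i, ∀ x ∈ P i, c i ≤ v x) {x : E} (hx : x ∈ convTuple P)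
    (hxc : v x = ∑ i, c i) :
    x ∈ convTuple (faceTuple P v) ∧ ∀ i, ∀ y ∈ faceTuple P v i, v y = c i := by
  obtain ⟨y, hy, rfl⟩ := mem_convTuple_iff.1 hx
  have hge : ∀ i, c i ≤ v (y i) := fun i =>
    convexHull_min (hP i) (convex_halfSpace_ge v.isLinear (c i)) (hy i)
  have heq : ∀ i, v (y i) = c i := by
    rw [map_sum, eq_comm, Finset.sum_eq_sum_iff_of_le fun i _ => hge i] at hxc
    exact fun i => (hxc i (Finset.mem_univ i)).symm
  have hmem := fun i => mem_convexHull_inter_of_eq (hP i) (hy i) (heq i)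
  refine ⟨mem_convTuple_iff.2 ⟨y, fun i => convexHull_mono ?_ (hmem i), rfl⟩, fun i z hz => ?_⟩
  · rintro z ⟨hz, hzc⟩
    exact ⟨hz, fun z' hz' => hzc.trans_le (hP i z' hz')⟩
  · obtain ⟨z', hz', hz'c⟩ := convexHull_nonempty_iff.1 ⟨_, hmem i⟩
    exact le_antisymm (hz'c ▸ hz.2 z' hz') (hP i z hz.1)

end RealTuples


variable {n k : ℕ}

/-! ### Full-dimensional cells and tight cells -/

/-- A covector `v` of `ℝⁿ` with constants `c_0, …, c_k`. Such a pair `q = (v, c)` stands for the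
affine functions `x ↦ c_i - v x` on the summands, which share their linear part. -/
abbrev AffTuple (n k : ℕ) : Type := Module.Dual ℝ (Fin n → ℝ) × (Fin (k + 1) → ℝ)

/-- The value `c_i - v a` of the `i`-th affine function of `q = (v, c)` at the point `a`, as a linear
function of `q`. -/
def height (i : Fin (k + 1)) (a : Fin n → ℤ) : AffTuple n k →ₗ[ℝ] ℝ :=
  (LinearMap.proj i : (Fin (k + 1) → ℝ) →ₗ[ℝ] ℝ) ∘ₗ LinearMap.snd ℝ _ _ -
    Module.Dual.eval ℝ (Fin n → ℝ) (toReal a) ∘ₗ LinearMap.fst ℝ _ _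

@[simp]
lemma height_apply (i : Fin (k + 1)) (a : Fin n → ℤ) (q : AffTuple n k) :
    height i a q = q.2 i - q.1 (toReal a) := by
  simp [height]

/-- A cell is full-dimensional if an `AffTuple` is determined by its heights on the cell. By
`fullDim_iff` this says that the cell has dimension `n`. -/
def FullDim (C : PointConfig n k) : Prop :=
  ∀ q : AffTuple n k, (∀ i, ∀ a ∈ C i, height i a q = 0) → q = 0

/-- `q` lies below the weights `ω` on `A`: its heights are at most the weights. -/
def Below (A : PointConfig n k) (ω : Fin (k + 1) → (Fin n → ℤ) → ℝ) (q : AffTuple n k) : Prop :=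
  ∀ i, ∀ a ∈ A i, height i a q ≤ ω i a

/-- The cell of those points of `A` at which the height of `q` equals the weight. -/
def tight (A : PointConfig n k) (ω : Fin (k + 1) → (Fin n → ℤ) → ℝ) (q : AffTuple n k) :
    PointConfig n k :=
  open scoped Classical in fun i => (A i).filter fun a => height i a q = ω i a

/-- The weights of `w`, extended by `0` to points outside of the configuration. -/
def weightAt (A : PointConfig n k) : A.WeightVector →ₗ[ℝ] Fin (k + 1) → (Fin n → ℤ) → ℝ where
  toFun w i a := if h : a ∈ A i then w ⟨i, ⟨a, h⟩⟩ else 0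
  map_add' w w' := by
    ext i a
    by_cases h : a ∈ A i <;> simp [h]
  map_smul' r w := by
    ext i a
    by_cases h : a ∈ A i <;> simp [h]

lemma weightAt_of_mem {A : PointConfig n k} {i : Fin (k + 1)} {a : Fin n → ℤ} (h : a ∈ A i)
    (w : A.WeightVector) : A.weightAt w i a = w ⟨i, ⟨a, h⟩⟩ := by
  simp [weightAt, h]

variable {A C D : PointConfig n k} {ω : Fin (k + 1) → (Fin n → ℤ) → ℝ} {q : AffTuple n k}

lemma mem_tight {i : Fin (k + 1)} {a : Fin n → ℤ} :
    a ∈ tight A ω q i ↔ a ∈ A i ∧ height i a q = ω i a := by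
  simp [tight]

lemma tight_le : tight A ω q ≤ A := fun _ _ ha => (mem_tight.1 ha).1

lemma toReal_injective : Function.Injective (toReal (n := n)) := fun a b h => by
  ext j
  simpa [toReal] using congrFun h j

lemma FullDim.mono (hC : C.FullDim) (h : C ≤ D) : D.FullDim :=
  fun q hq => hC q fun i a ha => hq i a (h i ha)

lemma FullDim.nonempty (hC : C.FullDim) (i : Fin (k + 1)) : (C i).Nonempty := by
  by_contra hne
  rw [Finset.not_nonempty_iff_eq_empty] at hne
  have := hC (0, Pi.single i 1) fun j a ha => by
    rcases eq_or_ne j i with rfl | hj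
    · simp [hne] at ha
    · simp [hj]
  have := congrFun (congrArg Prod.snd this) i
  simp at this

lemma mem_realPts {i : Fin (k + 1)} {x : Fin n → ℝ} :
    x ∈ C.realPts i ↔ ∃ a ∈ C i, toReal a = x := by
  simp [realPts]

lemma sum_toReal_mem {a : Fin (k + 1) → Fin n → ℤ} (ha : ∀ i, a i ∈ C i) :
    ∑ i, toReal (a i) ∈ ∑ i, C.realPts i :=
  Set.mem_fintype_sum _ _ |>.2 ⟨fun i => toReal (a i), fun i => mem_realPts.2 ⟨_, ha i, rfl⟩, rfl⟩

lemma exists_of_mem_sum {x : Fin n → ℝ} (hx : x ∈ ∑ i, C.realPts i) :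
    ∃ a : Fin (k + 1) → Fin n → ℤ, (∀ i, a i ∈ C i) ∧ ∑ i, toReal (a i) = x := by
  obtain ⟨g, hg, rfl⟩ := (Set.mem_fintype_sum _ _).1 hx
  choose a ha hag using fun i => mem_realPts.1 (hg i)
  exact ⟨a, ha, by simp [hag]⟩

/-- A cell is full-dimensional exactly when its Minkowski sum spans `ℝⁿ`. -/
lemma fullDim_iff : C.FullDim ↔ C.dim = n := by
  have hn : (n : ℤ) = Module.finrank ℝ (Fin n → ℝ) := by simp
  rw [dim, hn, dimSet_eq_finrank_iff]
  constructor
  · intro hC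
    choose b hb using hC.nonempty
    refine ⟨⟨_, sum_toReal_mem hb⟩, fun v c hv => ?_⟩
    -- Exchanging one summand shows that a covector constant on the sum is constant on each summand.
    have := hC (v, fun i => v (toReal (b i))) fun i a ha => by
      have h1 := hv _ (sum_toReal_mem hb)
      have h2 := hv _ (sum_toReal_mem (a := Function.update b i a) fun j => by
        rcases eq_or_ne j i with rfl | hj
        · simpa using ha
        · simpa [hj] using hb j)
      rw [← h2, map_sum, map_sum, ← Finset.add_sum_erase _ _ (Finset.mem_univ i),
        ← Finset.add_sum_erase _ _ (Finset.mem_univ i)] at h1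
      have h3 : ∑ j ∈ Finset.univ.erase i, v (toReal (Function.update b i a j)) =
          ∑ j ∈ Finset.univ.erase i, v (toReal (b j)) :=
        Finset.sum_congr rfl fun j hj => by simp [Finset.ne_of_mem_erase hj]
      rw [h3, Function.update_self] at h1
      rw [height_apply, sub_eq_zero]
      exact add_right_cancel h1
    exact congrArg Prod.fst this
  · rintro ⟨⟨x, hx⟩, h⟩ ⟨v, c⟩ hq
    obtain ⟨b, hb, -⟩ := exists_of_mem_sum hx
    have hv : ∀ i, ∀ a ∈ C i, v (toReal a) = c i := fun i a ha => by
      have := hq i a ha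
      rw [height_apply, sub_eq_zero] at this
      exact this.symm
    have hv0 : v = 0 := h v (∑ i, c i) fun y hy => by
      obtain ⟨a, ha, rfl⟩ := exists_of_mem_sum hy
      rw [map_sum]
      exact Finset.sum_congr rfl fun i _ => hv i _ (ha i)
    refine Prod.ext hv0 (funext fun i => ?_)
    simpa [hv0] using (hv i _ (hb i)).symm

lemma dimSet_conv (C : PointConfig n k) : dimSet C.conv = C.dim :=
  dimSet_convexHull _

/-- The covector `(x, t) ↦ v x + t` of `ℝⁿ × ℝ`. -/
def liftDual (v : Module.Dual ℝ (Fin n → ℝ)) : Module.Dual ℝ ((Fin n → ℝ) × ℝ) :=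
  v.coprod LinearMap.id

/-- A face of the lifted configuration that is cut out by a nonvertical covector has the same
dimension as its projection to `ℝⁿ`. -/
lemma dimSet_convTuple_faceTuple {P : Fin (k + 1) → Set ((Fin n → ℝ) × ℝ)}
    {γ : Module.Dual ℝ ((Fin n → ℝ) × ℝ)} (hγ : 0 < γ (0, 1))
    (hC : ∀ i, C.realPts i = Prod.fst '' faceTuple P γ i) :
    dimSet (convTuple (faceTuple P γ)) = C.dim := by
  have himg : (∑ i, C.realPts i) = LinearMap.fst ℝ (Fin n → ℝ) ℝ '' ∑ i, faceTuple P γ i := by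
    rw [Set.image_finsetSum]
    exact Finset.sum_congr rfl fun i _ => hC i
  rw [convTuple, dimSet_convexHull, dim, himg, dimSet_image_of_disjoint_ker]
  have hle : vectorSpan ℝ (∑ i, faceTuple P γ i) ≤ LinearMap.ker γ := by
    rw [vectorSpan, Submodule.span_le]
    rintro _ ⟨x, hx, y, hy, rfl⟩
    obtain ⟨f, hf, rfl⟩ := (Set.mem_fintype_sum _ _).1 hx
    obtain ⟨g, hg, rfl⟩ := (Set.mem_fintype_sum _ _).1 hy
    have : ∀ i, γ (f i) = γ (g i) := fun i =>
      le_antisymm ((hf i).2 _ (hg i).1) ((hg i).2 _ (hf i).1)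
    simp [this]
  refine Disjoint.mono_left hle (Submodule.disjoint_def.2 ?_)
  rintro ⟨x, t⟩ h1 h2
  obtain rfl : x = 0 := h2
  have h3 : γ (0, t) = t * γ (0, 1) := by
    rw [← smul_eq_mul, ← map_smul]
    simp
  rw [LinearMap.mem_ker, h3] at h1
  simpa [hγ.ne'] using h1

/-- The cells of the coherent subdivision are the full-dimensional tight cells. -/
lemma mem_coherentSubdivision_iff (hA : A.dim = n) {w : A.WeightVector} :
    C ∈ A.coherentSubdivision w ↔ ∃ q : AffTuple n k, Below A (A.weightAt w) q ∧
      C = tight A (A.weightAt w) q ∧ C.FullDim := by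
  constructor
  · rintro ⟨_, ⟨hdim, γ, hγ, rfl⟩, hC⟩
    rw [dimSet_convTuple_faceTuple hγ hC, hA] at hdim
    have hCf := fullDim_iff.2 hdim
    choose b hb using hCf.nonempty
    have hex : ∀ i, ∃ p ∈ A.lifted w i, ∀ y ∈ A.lifted w i, γ p ≤ γ y := fun i => by
      have : toReal (b i) ∈ C.realPts i := mem_realPts.2 ⟨_, hb i, rfl⟩
      rw [hC i] at this
      obtain ⟨p, hp, -⟩ := this
      exact ⟨p, hp⟩
    choose p hp hpmin using hex
    set s := γ (0, 1) with hs
    have hγv : ∀ x t, γ (x, t) = γ (x, 0) + s * t := fun x t => by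
      have : ((x, t) : (Fin n → ℝ) × ℝ) = (x, 0) + t • (0, 1) := by simp
      rw [this, map_add, map_smul, smul_eq_mul, mul_comm]
    -- The covector `γ` is rescaled so that its last coordinate becomes `1`.
    let q : AffTuple n k := (s⁻¹ • γ ∘ₗ LinearMap.inl ℝ _ _, fun i => s⁻¹ * γ (p i))
    have hq : ∀ i a t, γ (toReal a, t) - γ (p i) = s * (t - height i a q) := fun i a t => by
      rw [hγv]
      simp only [q, height_apply, LinearMap.smul_apply, LinearMap.comp_apply,
        LinearMap.inl_apply, smul_eq_mul]
      field_simp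
      ring
    refine ⟨q, fun i a ha => ?_, ?_, hCf⟩
    · have h1 := hpmin i (toReal a, w ⟨i, ⟨a, ha⟩⟩) ⟨⟨a, ha⟩, rfl⟩
      rw [weightAt_of_mem ha]
      have h2 := hq i a (w ⟨i, ⟨a, ha⟩⟩)
      have h3 : 0 ≤ s * (w ⟨i, ⟨a, ha⟩⟩ - height i a q) := by rw [← h2]; linarith
      linarith [nonneg_of_mul_nonneg_right h3 hγ]
    · funext i
      ext a
      have h1 : a ∈ C i ↔ toReal a ∈ C.realPts i := by
        rw [mem_realPts]
        simp [toReal_injective.eq_iff]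
      rw [h1, hC i, mem_tight]
      constructor
      · rintro ⟨_, ⟨⟨a', rfl⟩, hmin⟩, ha'⟩
        obtain rfl : a'.1 = a := toReal_injective ha'
        refine ⟨a'.2, ?_⟩
        rw [weightAt_of_mem a'.2]
        have h2 := hq i a'.1 (w ⟨i, a'⟩)
        have h3 := hmin _ (hp i)
        have h4 := hpmin i (toReal a'.1, w ⟨i, a'⟩) ⟨a', rfl⟩
        have h5 : s * (w ⟨i, a'⟩ - height i a'.1 q) = 0 := by rw [← h2]; linarith
        have h6 := (mul_eq_zero.1 h5).resolve_left hγ.ne'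
        linarith
      · rintro ⟨ha, hta⟩
        rw [weightAt_of_mem ha] at hta
        refine ⟨(toReal a, w ⟨i, ⟨a, ha⟩⟩), ⟨⟨⟨a, ha⟩, rfl⟩, fun y hy => ?_⟩, rfl⟩
        have h2 := hq i a (w ⟨i, ⟨a, ha⟩⟩)
        rw [hta, sub_self, mul_zero, sub_eq_zero] at h2
        exact h2.trans_le (hpmin i y hy)
  · rintro ⟨q, hq, rfl, hfull⟩
    set C := tight A (A.weightAt w) q with hC
    have hγ : 0 < liftDual q.1 (0, 1) := by simp [liftDual]
    have hC' : ∀ i, C.realPts i = Prod.fst '' faceTuple (A.lifted w) (liftDual q.1) i := fun i => by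
      obtain ⟨b, hb⟩ := hfull.nonempty i
      obtain ⟨hbA, hbt⟩ := mem_tight.1 hb
      ext x
      rw [mem_realPts]
      constructor
      · rintro ⟨a, ha, rfl⟩
        obtain ⟨haA, hat⟩ := mem_tight.1 ha
        refine ⟨(toReal a, w ⟨i, ⟨a, haA⟩⟩), ⟨⟨⟨a, haA⟩, rfl⟩, ?_⟩, rfl⟩
        rintro _ ⟨a', rfl⟩
        have := hq i a'.1 a'.2
        rw [weightAt_of_mem a'.2, height_apply] at this
        rw [weightAt_of_mem haA, height_apply] at hat
        simp only [liftDual, LinearMap.coprod_apply, LinearMap.id_apply]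
        linarith
      · rintro ⟨_, ⟨⟨a, rfl⟩, hmin⟩, rfl⟩
        refine ⟨a.1, mem_tight.2 ⟨a.2, ?_⟩, rfl⟩
        have h1 := hmin (toReal b, w ⟨i, ⟨b, hbA⟩⟩) ⟨⟨b, hbA⟩, rfl⟩
        simp only [liftDual, LinearMap.coprod_apply, LinearMap.id_apply] at h1
        have h2 := hq i a.1 a.2
        rw [weightAt_of_mem a.2, height_apply] at h2 ⊢
        rw [weightAt_of_mem hbA, height_apply] at hbt
        linarith
    refine ⟨_, ⟨?_, _, hγ, rfl⟩, hC'⟩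
    rw [dimSet_convTuple_faceTuple hγ hC', hA, fullDim_iff.1 hfull]

/-- Two tight cells meet along a common face, cut out of the first by the difference of the two
covectors. -/
lemma isFace_tight_inter {q₁ q₂ : AffTuple n k} (h₁ : Below A ω q₁) (h₂ : Below A ω q₂) :
    IsFace ((tight A ω q₁).conv ∩ (tight A ω q₂).conv) (tight A ω q₁) := by
  rcases Set.eq_empty_or_nonempty ((tight A ω q₁).conv ∩ (tight A ω q₂).conv) with h | ⟨x, hx1, hx2⟩
  · exact Or.inl h
  have key : ∀ {q q' : AffTuple n k}, Below A ω q' →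
      ∀ i, ∀ y ∈ (tight A ω q).realPts i, (q'.2 - q.2) i ≤ (q'.1 - q.1) y := by
    rintro q q' h' i _ hy
    obtain ⟨a, ha, rfl⟩ := mem_realPts.1 hy
    obtain ⟨haA, hat⟩ := mem_tight.1 ha
    have := h' i a haA
    rw [height_apply] at this hat
    simp only [Pi.sub_apply, LinearMap.sub_apply]
    linarith
  have hval : ∀ y, y ∈ (tight A ω q₁).conv → y ∈ (tight A ω q₂).conv →
      (q₂.1 - q₁.1) y = ∑ i, (q₂.2 - q₁.2) i := by
    intro y hy1 hy2
    have h3 := sum_le_of_mem_convTuple (key h₂) hy1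
    have h4 := sum_le_of_mem_convTuple (key h₁) hy2
    simp only [Pi.sub_apply, Finset.sum_sub_distrib, LinearMap.sub_apply] at h3 h4 ⊢
    linarith
  refine Or.inr ⟨q₂.1 - q₁.1, Set.Subset.antisymm ?_ ?_⟩
  · rintro y ⟨hy1, hy2⟩
    exact (mem_convTuple_faceTuple (key h₂) hy1 (hval y hy1 hy2)).1
  · have hc := (mem_convTuple_faceTuple (key h₂) hx1 (hval x hx1 hx2)).2
    refine Set.subset_inter (convTuple_mono fun i y hy => hy.1) (convTuple_mono fun i y hy => ?_)
    have hyc := hc i y hy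
    obtain ⟨a, ha, rfl⟩ := mem_realPts.1 hy.1
    obtain ⟨haA, hat⟩ := mem_tight.1 ha
    refine mem_realPts.2 ⟨a, mem_tight.2 ⟨haA, ?_⟩, rfl⟩
    rw [height_apply] at hat ⊢
    simp only [Pi.sub_apply, LinearMap.sub_apply] at hyc
    linarith

/-! ### The full-dimensional tight cells cover -/

lemma conv_mono (h : C ≤ D) : C.conv ⊆ D.conv :=
  convTuple_mono fun i => Set.image_mono (Finset.coe_subset.2 (h i))

/-- The value `∑ i, c_i - v x` of the sum of the affine functions of `q = (v, c)` at the point `x` of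
the Minkowski sum, as a linear function of `q`. -/
def totalHeight (x : Fin n → ℝ) : AffTuple n k →ₗ[ℝ] ℝ :=
  (∑ i, LinearMap.proj i : (Fin (k + 1) → ℝ) →ₗ[ℝ] ℝ) ∘ₗ LinearMap.snd ℝ _ _ -
    Module.Dual.eval ℝ (Fin n → ℝ) x ∘ₗ LinearMap.fst ℝ _ _

lemma totalHeight_apply (x : Fin n → ℝ) (q : AffTuple n k) :
    totalHeight x q = ∑ i, q.2 i - q.1 x := by
  simp [totalHeight]

/-- If `c_i - v a` is nonpositive on all points of `C_i`, then `∑ i, c_i - v x` is nonpositive on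
`conv C`. -/
lemma totalHeight_nonpos {x : Fin n → ℝ} (hx : x ∈ C.conv) (hq : ∀ i, ∀ a ∈ C i, height i a q ≤ 0) :
    totalHeight x q ≤ 0 := by
  rw [totalHeight_apply]
  refine sub_nonpos.2 (sum_le_of_mem_convTuple (fun i y hy => ?_) hx)
  obtain ⟨a, ha, rfl⟩ := mem_realPts.1 hy
  simpa using hq i a ha

lemma finite_Iic (A : PointConfig n k) : (Set.Iic A).Finite := by
  have : Set.Iic A = Set.univ.pi fun i => Set.Iic (A i) := by
    ext C
    simp [Pi.le_def]
  rw [this]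
  exact Set.Finite.pi fun i => Set.finite_Iic (A i)

/-- If the tight cell of `q` is not full-dimensional, then `q` can be moved so that further points
become tight, the tight ones stay tight, and the value of `totalHeight x` does not decrease. -/
lemma exists_tight_lt (hA : A.FullDim) {x : Fin n → ℝ} (hx : x ∈ A.conv) (hq : Below A ω q)
    (hnot : ¬ (tight A ω q).FullDim) :
    ∃ q' : AffTuple n k, Below A ω q' ∧ tight A ω q < tight A ω q' ∧
      totalHeight x q ≤ totalHeight x q' := by
  have hpos : ∀ d : AffTuple n k, 0 < totalHeight x d → ∃ i, ∃ a ∈ A i, 0 < height i a d := by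
    intro d hd
    by_contra! h
    exact hd.not_ge (totalHeight_nonpos hx h)
  -- The direction of the move: up to sign, any nonzero `d` of height `0` on the tight cell.
  obtain ⟨d, hdt, hdx, i₀, a₀, ha₀, hd₀⟩ : ∃ d : AffTuple n k,
      (∀ i, ∀ a ∈ tight A ω q i, height i a d = 0) ∧ 0 ≤ totalHeight x d ∧
      ∃ i, ∃ a ∈ A i, 0 < height i a d := by
    unfold FullDim at hnot
    push Not at hnot
    obtain ⟨d, hdt, hd0⟩ := hnot
    have hneg : totalHeight x (-d) = -totalHeight x d := map_neg _ _
    have hdt' : ∀ i, ∀ a ∈ tight A ω q i, height i a (-d) = 0 := fun i a ha => by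
      rw [map_neg, hdt i a ha, neg_zero]
    rcases lt_trichotomy (totalHeight x d) 0 with h | h | h
    · have h' : 0 < totalHeight x (-d) := by
        rw [hneg]
        linarith
      exact ⟨-d, hdt', h'.le, hpos _ h'⟩
    · obtain ⟨i, a, ha, hne⟩ : ∃ i, ∃ a ∈ A i, height i a d ≠ 0 := by
        by_contra! h'
        exact hd0 (hA d h')
      rcases hne.lt_or_gt with hlt | hgt
      · refine ⟨-d, hdt', by rw [hneg, h, neg_zero], i, a, ha, ?_⟩
        rw [map_neg]
        linarith
      · exact ⟨d, hdt, h.ge, i, a, ha, hgt⟩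
    · exact ⟨d, hdt, h.le, hpos _ h⟩
  -- The length of the move: the first time that a point of positive slope becomes tight.
  classical
  obtain ⟨⟨i₁, a₁⟩, hmem, hmin⟩ := Finset.exists_min_image
    ((Finset.univ.sigma A).filter fun t => 0 < height t.1 t.2 d)
    (fun t => (ω t.1 t.2 - height t.1 t.2 q) / height t.1 t.2 d)
    ⟨⟨i₀, a₀⟩, by simpa only [Finset.mem_filter, Finset.mem_sigma, Finset.mem_univ,
      true_and] using ⟨ha₀, hd₀⟩⟩
  obtain ⟨ha₁, hd₁⟩ : a₁ ∈ A i₁ ∧ 0 < height i₁ a₁ d := by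
    simpa only [Finset.mem_filter, Finset.mem_sigma, Finset.mem_univ, true_and] using hmem
  set s := (ω i₁ a₁ - height i₁ a₁ q) / height i₁ a₁ d with hs
  have hs0 : 0 ≤ s := div_nonneg (sub_nonneg.2 (hq i₁ a₁ ha₁)) hd₁.le
  have hval : ∀ i a, height i a (q + s • d) = height i a q + s * height i a d := fun i a => by
    rw [map_add, map_smul, smul_eq_mul]
  have hle : tight A ω q ≤ tight A ω (q + s • d) := fun i a ha => by
    rw [mem_tight, hval, hdt i a ha, mul_zero, add_zero]
    exact mem_tight.1 ha
  refine ⟨q + s • d, fun i a ha => ?_, lt_of_le_not_ge hle fun hge => ?_, ?_⟩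
  · rw [hval]
    rcases le_or_gt (height i a d) 0 with h | h
    · nlinarith [hq i a ha, mul_nonneg hs0 (neg_nonneg.2 h)]
    · have := hmin ⟨i, a⟩ (by simpa only [Finset.mem_filter, Finset.mem_sigma, Finset.mem_univ,
        true_and] using ⟨ha, h⟩)
      have := (le_div_iff₀ h).1 this
      linarith
  · have h1 : a₁ ∈ tight A ω (q + s • d) i₁ := by
      refine mem_tight.2 ⟨ha₁, ?_⟩
      rw [hval, hs, div_mul_cancel₀ _ hd₁.ne']
      ring
    exact hd₁.ne' (hdt i₁ a₁ (hge i₁ h1))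
  · rw [map_add, map_smul, smul_eq_mul]
    linarith [mul_nonneg hs0 hdx]

/-- Moving `q` until its tight cell is full-dimensional, as in the simplex method. -/
lemma exists_fullDim_tight (hA : A.FullDim) {x : Fin n → ℝ} (hx : x ∈ A.conv)
    (hq : Below A ω q) :
    ∃ q' : AffTuple n k, Below A ω q' ∧ (tight A ω q').FullDim ∧
      totalHeight x q ≤ totalHeight x q' := by
  obtain ⟨q', ⟨hq', hle⟩, hmax⟩ := Set.Finite.exists_maximalFor' (tight A ω)
    {q' : AffTuple n k | Below A ω q' ∧ totalHeight x q ≤ totalHeight x q'}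
    ((finite_Iic A).subset (by rintro _ ⟨q', -, rfl⟩; exact tight_le)) ⟨q, hq, le_rfl⟩
  refine ⟨q', hq', ?_, hle⟩
  by_contra hnot
  obtain ⟨q'', h1, h2, h3⟩ := exists_tight_lt hA hx hq' hnot
  exact h2.not_ge (hmax ⟨h1, hle.trans h3⟩ h2.le)

lemma exists_below (A : PointConfig n k) (ω : Fin (k + 1) → (Fin n → ℤ) → ℝ) :
    ∃ q : AffTuple n k, Below A ω q := by
  choose c hc using fun i => ((A i).finite_toSet.image (ω i)).bddBelow
  exact ⟨(0, c), fun i a ha => by simpa using hc i ⟨a, ha, rfl⟩⟩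

/-- If `q` maximizes `totalHeight x` among all `q` below the weights, then `x` lies in the convex
hull of the tight cell: otherwise a hyperplane separating them gives a direction of increase. -/
lemma mem_conv_tight_of_max {x : Fin n → ℝ} (hq : Below A ω q) (hfull : (tight A ω q).FullDim)
    (hmax : ∀ q' : AffTuple n k, Below A ω q' → totalHeight x q' ≤ totalHeight x q) :
    x ∈ (tight A ω q).conv := by
  by_contra hx
  have hclosed : IsClosed (tight A ω q).conv := by
    have hfin : (∑ i, (tight A ω q).realPts i).Finite :=
      Finset.sum_induction _ Set.Finite (fun _ _ => Set.Finite.add) Set.finite_zero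
        fun i _ => (tight A ω q i).finite_toSet.image _
    exact hfin.isClosed_convexHull ℝ
  obtain ⟨v, u, hxu, hu⟩ := geometric_hahn_banach_point_closed (convex_convexHull _ _) hclosed hx
  choose b hb hbmin using fun i =>
    Finset.exists_min_image (tight A ω q i) (fun a => v (toReal a)) (hfull.nonempty i)
  let d : AffTuple n k := (v.toLinearMap, fun i => v (toReal (b i)))
  have hd : ∀ i, ∀ a ∈ tight A ω q i, height i a d ≤ 0 := fun i a ha => by
    simpa [d] using hbmin i a ha
  have hdx : 0 < totalHeight x d := by
    have := hu _ (subset_convexHull ℝ _ (sum_toReal_mem hb))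
    rw [map_sum] at this
    simp only [d, totalHeight_apply, ContinuousLinearMap.coe_coe]
    linarith
  -- A small step in the direction `d` keeps the slack of all points that are not tight.
  have hev : ∀ᶠ s : ℝ in nhdsWithin 0 (Set.Ioi 0), Below A ω (q + s • d) := by
    have : ∀ i, ∀ a ∈ A i, ∀ᶠ s : ℝ in nhdsWithin 0 (Set.Ioi 0), height i a (q + s • d) ≤ ω i a := by
      intro i a ha
      simp only [map_add, map_smul, smul_eq_mul]
      by_cases hat : a ∈ tight A ω q i
      · filter_upwards [self_mem_nhdsWithin] with s hs
        have h1 := mul_nonneg (le_of_lt (Set.mem_Ioi.1 hs)) (neg_nonneg.2 (hd i a hat))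
        linarith [hq i a ha]
      · have hlt : height i a q < ω i a :=
          lt_of_le_of_ne (hq i a ha) fun h => hat (mem_tight.2 ⟨ha, h⟩)
        have hc : Filter.Tendsto (fun s : ℝ => height i a q + s * height i a d)
            (nhdsWithin 0 (Set.Ioi 0)) (nhds (height i a q + 0 * height i a d)) :=
          Continuous.tendsto (by fun_prop) 0 |>.mono_left nhdsWithin_le_nhds
        rw [zero_mul, add_zero] at hc
        exact (hc.eventually_lt_const hlt).mono fun s hs => hs.le
    exact Filter.eventually_all.2 fun i => (Filter.eventually_all_finset (A i)).2 (this i)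
  obtain ⟨s, hs, hs0⟩ := (hev.and self_mem_nhdsWithin).exists
  have h1 := hmax _ hs
  rw [map_add, map_smul, smul_eq_mul] at h1
  linarith [mul_pos (Set.mem_Ioi.1 hs0) hdx]

/-- Every point `x` of `conv A` lies in a full-dimensional tight cell. There are finitely many `q`
below the weights with a full-dimensional tight cell, so one of them maximizes `totalHeight x` among
these, and then among all `q` below the weights. -/
lemma exists_mem_conv_tight (hA : A.FullDim) (ω : Fin (k + 1) → (Fin n → ℤ) → ℝ)
    {x : Fin n → ℝ} (hx : x ∈ A.conv) :
    ∃ q : AffTuple n k, Below A ω q ∧ (tight A ω q).FullDim ∧ x ∈ (tight A ω q).conv := by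
  let V : Set (AffTuple n k) := {q | Below A ω q ∧ (tight A ω q).FullDim}
  have hV : V.Finite := by
    refine Set.Finite.of_finite_image (f := tight A ω)
      ((finite_Iic A).subset (by rintro _ ⟨q', -, rfl⟩; exact tight_le)) ?_
    intro q hq q' hq' h
    refine sub_eq_zero.1 (hq.2 _ fun i a ha => ?_)
    rw [map_sub, (mem_tight.1 ha).2, sub_eq_zero]
    exact ((mem_tight.1 (h ▸ ha)).2).symm
  obtain ⟨q₀, hq₀⟩ := exists_below A ω
  obtain ⟨q₁, h₁, h₁', -⟩ := exists_fullDim_tight hA hx hq₀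
  obtain ⟨q, hq, hmax⟩ := Set.exists_max_image V (fun q => totalHeight x q) hV ⟨q₁, h₁, h₁'⟩
  refine ⟨q, hq.1, hq.2, mem_conv_tight_of_max hq.1 hq.2 fun q' hq' => ?_⟩
  obtain ⟨q'', h1, h2, h3⟩ := exists_fullDim_tight hA hx hq'
  exact h3.trans (hmax q'' ⟨h1, h2⟩)

/-- Coherent subdivisions of configurations of full dimension are subdivisions, for all weights. -/
lemma isSubdivision_coherentSubdivision (hA : A.dim = n) (w : A.WeightVector) :
    A.IsSubdivision (A.coherentSubdivision w) where
  finite := (finite_Iic A).subset fun C hC => by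
    obtain ⟨q, -, rfl, -⟩ := (mem_coherentSubdivision_iff hA).1 hC
    exact tight_le
  isCell C hC := by
    obtain ⟨q, -, rfl, -⟩ := (mem_coherentSubdivision_iff hA).1 hC
    exact tight_le
  dim_eq C hC := by
    obtain ⟨q, -, -, hfull⟩ := (mem_coherentSubdivision_iff hA).1 hC
    rw [dimSet_conv, hA, fullDim_iff.1 hfull]
  inter C₁ h₁ C₂ h₂ := by
    obtain ⟨q₁, hq₁, rfl, -⟩ := (mem_coherentSubdivision_iff hA).1 h₁
    obtain ⟨q₂, hq₂, rfl, -⟩ := (mem_coherentSubdivision_iff hA).1 h₂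
    refine ⟨isFace_tight_inter hq₁ hq₂, ?_⟩
    rw [Set.inter_comm]
    exact isFace_tight_inter hq₂ hq₁
  cover := by
    refine Set.Subset.antisymm (Set.iUnion₂_subset fun C hC => ?_) fun x hx => ?_
    · obtain ⟨q, -, rfl, -⟩ := (mem_coherentSubdivision_iff hA).1 hC
      exact conv_mono tight_le
    · obtain ⟨q, h1, h2, h3⟩ := exists_mem_conv_tight (fullDim_iff.2 hA) (A.weightAt w) hx
      exact Set.mem_iUnion₂.2 ⟨_, (mem_coherentSubdivision_iff hA).2 ⟨q, h1, rfl, h2⟩, h3⟩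

/-! ### Generic weights -/

/-- The linear map that sends `q` to its heights on the points of a cell. -/
def heights (C : PointConfig n k) : AffTuple n k →ₗ[ℝ] (Σ i, C i) → ℝ :=
  LinearMap.pi fun t => height t.1 t.2.1

/-- The restriction of a weight vector to the points of a cell. -/
def weightsOn (A C : PointConfig n k) : A.WeightVector →ₗ[ℝ] (Σ i, C i) → ℝ where
  toFun w t := A.weightAt w t.1 t.2.1
  map_add' w w' := by
    ext t
    simp
  map_smul' r w := by
    ext t
    simp

/-- The subspace of those weight vectors whose restriction to the cell `C` consists of the heights
of some `q`. -/
def liftSubmodule (A C : PointConfig n k) : Submodule ℝ A.WeightVector :=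
  (LinearMap.range C.heights).comap (A.weightsOn C)

lemma mem_liftSubmodule_tight (w : A.WeightVector) (q : AffTuple n k) :
    w ∈ A.liftSubmodule (tight A (A.weightAt w) q) :=
  ⟨q, funext fun t => (mem_tight.1 t.2.2).2⟩

lemma weightsOn_surjective (hC : C ≤ A) : Function.Surjective (A.weightsOn C) := by
  classical
  intro f
  refine ⟨WithLp.toLp 2 fun t => if h : t.2.1 ∈ C t.1 then f ⟨t.1, ⟨t.2.1, h⟩⟩ else 0, ?_⟩
  ext ⟨i, a, ha⟩
  simp [weightsOn, weightAt_of_mem (hC i ha), ha]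

lemma FullDim.heights_injective (hC : C.FullDim) : Function.Injective C.heights := by
  rw [injective_iff_map_eq_zero]
  exact fun q hq => hC q fun i a ha => congrFun hq ⟨i, ⟨a, ha⟩⟩

lemma heights_surjective (hC : C ≤ A) (h : A.liftSubmodule C = ⊤) :
    Function.Surjective C.heights := by
  intro f
  obtain ⟨w, rfl⟩ := weightsOn_surjective hC f
  have : w ∈ A.liftSubmodule C := h ▸ Submodule.mem_top
  exact this

/-- If all functions on a full-dimensional cell are heights, the cell has `n + k + 1` points,
counted with their index. -/
lemma sum_card_sub_one (hC : C.FullDim) (hsurj : Function.Surjective C.heights) :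
    ∑ j, (((C j).card : ℤ) - 1) = n := by
  have h := (LinearEquiv.ofBijective C.heights ⟨hC.heights_injective, hsurj⟩).finrank_eq
  rw [Module.finrank_prod, Subspace.dual_finrank_eq, Module.finrank_fintype_fun_eq_card,
    Module.finrank_fintype_fun_eq_card, Module.finrank_fintype_fun_eq_card] at h
  simp only [Fintype.card_fin, Fintype.card_sigma, Fintype.card_coe] at h
  rw [Finset.sum_sub_distrib, ← Nat.cast_sum, ← h]
  simp

/-- If all functions on a cell are heights, each entry of the cell is affinely independent. -/
lemma dimSet_convexHull_realPts (hsurj : Function.Surjective C.heights) {j : Fin (k + 1)}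
    (hj : (C j).Nonempty) :
    dimSet (convexHull ℝ (C.realPts j)) = ((C j).card : ℤ) - 1 := by
  classical
  have hind : AffineIndependent ℝ fun a : C j => toReal a.1 := by
    rw [affineIndependent_iff]
    intro s l hl hls a₀ ha₀
    obtain ⟨q, hq⟩ := hsurj (Pi.single ⟨j, a₀⟩ 1)
    -- A `q` of height `1` at `a₀` and `0` elsewhere isolates the coefficient of `a₀`.
    have hqa : ∀ a : C j, height j a.1 q = if a = a₀ then 1 else 0 := fun a => by
      have := congrFun hq ⟨j, a⟩
      simpa [heights, Pi.single_apply] using this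
    have h1 : ∑ a ∈ s, l a * height j a.1 q = l a₀ := by
      simp [hqa, ha₀]
    have h2 : q.1 (∑ a ∈ s, l a • toReal a.1) = ∑ a ∈ s, l a * q.1 (toReal a.1) := by
      simp
    rw [← h1]
    simp only [height_apply, mul_sub, Finset.sum_sub_distrib, ← Finset.sum_mul]
    rw [hl, ← h2, hls, map_zero, zero_mul, sub_zero]
  have hrange : C.realPts j = Set.range fun a : C j => toReal a.1 := by
    ext x
    simp [mem_realPts]
  have hcard : Fintype.card (C j) = ((C j).card - 1) + 1 := by
    rw [Fintype.card_coe, Nat.sub_add_cancel hj.card_pos]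
  rw [dimSet_convexHull, dimSet, direction_affineSpan, hrange, hind.finrank_vectorSpan hcard,
    if_pos, Nat.cast_sub hj.card_pos, Nat.cast_one]
  obtain ⟨a, ha⟩ := hj
  exact ⟨_, ⟨a, ha⟩, rfl⟩

/-- For weights outside of the proper subspaces among the `liftSubmodule`s, every function on a cell
of the coherent subdivision consists of heights, and so the subdivision is fine mixed. -/
lemma isFineMixed_coherentSubdivision (hA : A.dim = n) {w : A.WeightVector}
    (hw : ∀ C ≤ A, A.liftSubmodule C ≠ ⊤ → w ∉ A.liftSubmodule C) :
    A.IsFineMixed (A.coherentSubdivision w) := by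
  have key : ∀ C ∈ A.coherentSubdivision w, C.FullDim ∧ Function.Surjective C.heights := by
    intro C hC
    obtain ⟨q, hq, rfl, hfull⟩ := (mem_coherentSubdivision_iff hA).1 hC
    refine ⟨hfull, heights_surjective tight_le ?_⟩
    by_contra hne
    exact hw _ tight_le hne (mem_liftSubmodule_tight w q)
  refine ⟨⟨isSubdivision_coherentSubdivision hA w, fun C hC => ?_⟩, fun C hC => ?_⟩
  · obtain ⟨h1, h2⟩ := key C hC
    rw [hA, ← sum_card_sub_one h1 h2]
    exact Finset.sum_congr rfl fun j _ => dimSet_convexHull_realPts h2 (h1.nonempty j)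
  · rw [hA, sum_card_sub_one (key C hC).1 (key C hC).2]

/-! ### Refinement -/

/-- The weights for which a given full-dimensional cell lies in a tight cell form a closed set: the
`q` in question depends linearly on the weights. -/
lemma isClosed_setOf_le_tight (hCA : C ≤ A) (hC : C.FullDim) :
    IsClosed {w : A.WeightVector | ∃ q : AffTuple n k, Below A (A.weightAt w) q ∧
      C ≤ tight A (A.weightAt w) q} := by
  obtain ⟨G, hG⟩ := C.heights.exists_leftInverse_of_injective
    (LinearMap.ker_eq_bot.2 hC.heights_injective)
  let g : A.WeightVector →ₗ[ℝ] AffTuple n k := G ∘ₗ A.weightsOn C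
  have hheight : ∀ i a, Continuous fun w => height i a (g w) := fun i a =>
    (height i a ∘ₗ g).continuous_of_finiteDimensional
  have hweight : ∀ i a, Continuous fun w => A.weightAt w i a := fun i a =>
    (LinearMap.proj a ∘ₗ LinearMap.proj i ∘ₗ A.weightAt :
      A.WeightVector →ₗ[ℝ] ℝ).continuous_of_finiteDimensional
  have hset : {w : A.WeightVector | ∃ q : AffTuple n k, Below A (A.weightAt w) q ∧
      C ≤ tight A (A.weightAt w) q} =
      {w | (∀ i, ∀ a ∈ A i, height i a (g w) ≤ A.weightAt w i a) ∧
        ∀ i, ∀ a ∈ C i, height i a (g w) = A.weightAt w i a} := by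
    ext w
    constructor
    · rintro ⟨q, hq, hCq⟩
      have hgq : g w = q := by
        have h1 : A.weightsOn C w = C.heights q :=
          funext fun t => ((mem_tight.1 (hCq t.1 t.2.2)).2).symm
        rw [LinearMap.comp_apply, h1, ← LinearMap.comp_apply, hG, LinearMap.id_apply]
      rw [Set.mem_ofPred_eq, hgq]
      exact ⟨hq, fun i a ha => (mem_tight.1 (hCq i ha)).2⟩
    · rintro ⟨h1, h2⟩
      exact ⟨g w, h1, fun i a ha => mem_tight.2 ⟨hCA i ha, h2 i a ha⟩⟩
  rw [hset]
  simp only [Set.ofPred_and, Set.ofPred_forall]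
  exact (isClosed_iInter fun i => isClosed_iInter fun a => isClosed_iInter fun _ =>
    isClosed_le (hheight i a) (hweight i a)).inter
    (isClosed_iInter fun i => isClosed_iInter fun a => isClosed_iInter fun _ =>
      isClosed_eq (hheight i a) (hweight i a))

/-- Coherent subdivisions can only become finer under small changes of the weights. -/
lemma eventually_refines (hA : A.dim = n) (w : A.WeightVector) :
    ∀ᶠ w' in nhds w, Refines (A.coherentSubdivision w') (A.coherentSubdivision w) := by
  have hev : ∀ᶠ w' in nhds w, ∀ C ∈ Set.Iic A, C.FullDim →
      (∃ q : AffTuple n k, Below A (A.weightAt w') q ∧ C ≤ tight A (A.weightAt w') q) →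
      ∃ q : AffTuple n k, Below A (A.weightAt w) q ∧ C ≤ tight A (A.weightAt w) q := by
    refine (Filter.eventually_all_finite (finite_Iic A)).2 fun C hCA => ?_
    by_cases hC : C.FullDim
    · by_cases hw : ∃ q : AffTuple n k, Below A (A.weightAt w) q ∧ C ≤ tight A (A.weightAt w) q
      · exact Filter.Eventually.of_forall fun _ _ _ => hw
      · filter_upwards [(isClosed_setOf_le_tight hCA hC).isOpen_compl.mem_nhds hw] with w' hw' _ h
        exact absurd h hw'
    · exact Filter.Eventually.of_forall fun _ h => absurd h hC
  filter_upwards [hev] with w' hw' C hC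
  obtain ⟨q', hq', rfl, hfull⟩ := (mem_coherentSubdivision_iff hA).1 hC
  obtain ⟨q, hq, hle⟩ := hw' _ tight_le hfull ⟨q', hq', le_rfl⟩
  exact ⟨_, (mem_coherentSubdivision_iff hA).2 ⟨q, hq, rfl, hfull.mono hle⟩, hle⟩

end PointConfig

end

theorem lemma2p5 (n k : ℕ) (A : PointConfig n k) (hA : A.dim = (n : ℤ)) :
    ∃ H : Finset (Submodule ℝ A.WeightVector), (∀ V ∈ H, V ≠ ⊤) ∧
      ∀ w : A.WeightVector, ∃ ε₀ : ℝ, 0 < ε₀ ∧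
        ∀ ε : ℝ, 0 < ε → ε ≤ ε₀ →
          ∀ w' : A.WeightVector, (∀ V ∈ H, w' ∉ V) → ‖w - w'‖ < ε →
            A.IsFineMixed (A.coherentSubdivision w') ∧
              PointConfig.Refines (A.coherentSubdivision w') (A.coherentSubdivision w) := by
  have hfin : {V | ∃ C ≤ A, A.liftSubmodule C = V ∧ V ≠ ⊤}.Finite :=
    ((PointConfig.finite_Iic A).image A.liftSubmodule).subset fun V ⟨C, hC, hV, _⟩ => ⟨C, hC, hV⟩
  refine ⟨hfin.toFinset, fun V hV => ?_, fun w => ?_⟩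
  · obtain ⟨C, -, -, hne⟩ := hfin.mem_toFinset.1 hV
    exact hne
  obtain ⟨ε₀, hε₀, hball⟩ := Metric.eventually_nhds_iff.1 (PointConfig.eventually_refines hA w)
  refine ⟨ε₀, hε₀, fun ε _ hε w' hw' hlt => ⟨?_, hball ?_⟩⟩
  · exact PointConfig.isFineMixed_coherentSubdivision hA fun C hC hne =>
      hw' _ (hfin.mem_toFinset.2 ⟨C, hC, rfl, hne⟩)
  · rw [dist_comm, dist_eq_norm]
    exact hlt.trans_le hε
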